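/- Let $L>0$, $\nu>0$ and $\Omega=[0,L]^2$ with periodic boundary conditions. Let $H$ be the space of real divergence-free vector fields $U=\sum_{k}\widehat U_k e^{ik\cdot x}\in L^2(\Omega;\mathbb{R}^2)$ with zero average, $k\in\frac{2\pi}{L}\mathbb{Z}^2\setminus\{0\}$. For such vector fields, and likewise for scalar Fourier series, put $\|U\|_\alpha^2=L^2\sum_k|k|^{2\alpha}|\widehat U_k|^2$, $|U|=\|U\|_0$, $\|U\|=\|U\|_1$ and $|AU|=\|U\|_2$, where $A=-\Delta$; let $V_\alpha=\{U\in H:\|U\|_\alpha<\infty\}$, $V=V_1$, $\mathcal D(A)=V_2$. Put $\operatorname{curl}U=\partial_1U_2-\partial_2U_1$; for a scalar $\eta$ write $B(v,\eta)=(v\cdot\nabla)\eta$, and let $(\cdot,\cdot)$ be the inner product of $L^2(\Omega)$. There is an absolute constant $C>0$ (independent of $L$, $\nu$ and of everything below) with the following two properties. (a) For all $U\in\mathcal D(A)$ and $v\in V_3$, with $W=\operatorname{curl}U$ and $\xi=\operatorname{curl}v$, the integrals defining the three pairings below converge absolutely and $$|(B(v,W),A\xi)|\le C\frac{4^2}{3\nu^2}|v|^2\|W\|^3+\frac{\nu}{6}|A\xi|^2,$$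 $$|(B(v,\xi),A\xi)|\le C\frac{4^2}{3\nu^2}|v|^2\|\xi\|^3+\frac{\nu}{6}|A\xi|^2,$$ $$|(B(U,\xi),A\xi)|\le C\frac{5^5}{\nu^5}\|U\|_{L^\infty}^6|v|^2+\frac{\nu}{6}|A\xi|^2.$$ (b) Let $t_0\in\mathbb{R}$, $\delta,h,\lambda,c_1>0$, $t_n=t_0+n\delta$, and $f\in L^\infty([t_0,\infty);H)$. Let $I_h\colon\mathcal D(A)\to L^2(\Omega;\mathbb{R}^2)$ be linear with $\|\Phi-I_h\Phi\|_{L^2}^2\le c_1h^2(\|\Phi\|^2+h^2|A\Phi|^2)$ for all $\Phi\in\mathcal D(A)$. Let $J=P_\lambda P_\sigma I_h$ and $E=I-J$, where $P_\sigma$ is the orthogonal projection of $L^2(\Omega;\mathbb{R}^2)$ onto $H$ and $P_\lambda$ is the projection onto the modes with $|k|^2\le\lambda$. Let $U$ be a strong solution, with $U(t)\in\mathcal D(A)$ for all $t\ge t_0$, of the two-dimensional Navier--Stokes equations $$\frac{dU}{dt}+\nu AU+P_\sigma((U\cdot\nabla)U)=f$$ on $[t_0,\infty)$, and let $S(\cdot,s;w_0)$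 denote the strong solution of the same equation on $[s,\infty)$ with value $w_0$ at time $s$. Let $u$ be given by $u_0=JU(t_0)$, $u_{n+1}=ES(t_{n+1},t_n;u_n)+JU(t_{n+1})$ and $u(t)=S(t,t_n;u_n)$ for $t\in[t_n,t_{n+1})$, where each $S(\cdot,t_n;u_n)$ takes its values in $\mathcal D(A)$. Assume that $\int_t^{t+\delta}\|AU(s)\|^2\,ds<\infty$ for all $t\ge t_0$, and that $\int_a^b\|Au(s)\|^2\,ds<\infty$ whenever $t_n<a<b<t_{n+1}$ for some $n\ge0$. Then for almost every $t\ge t_0$ the difference $v(t)=U(t)-u(t)$ belongs to $V_3$, so that $|A\xi(t)|<\infty$ for $\xi(t)=\operatorname{curl}v(t)$, and the three bounds of (a) hold for $U=U(t)$, $W=\operatorname{curl}U(t)$, $v=v(t)$ and $\xi=\xi(t)$. -/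

import Mathlib

open MeasureTheory Set Filter Topology
open scoped ENNReal ComplexConjugate

noncomputable section

namespace NSE

/-- The index set `ℤ²` of the Fourier modes; `n` stands for the wave vector `k = (2π/L) n`. -/
abbrev Modes := Fin 2 → ℤ

/-- The periodic box `Ω = [0,L]²` with opposite sides identified; its volume is `L²`. -/
abbrev Torus (L : ℝ) := Fin 2 → AddCircle L

/-- Square summable families `(Û_k)` of vectors of `ℂ²`: the Fourier coefficients of the
`ℂ²`-valued square integrable functions on the torus. -/
abbrev FourierSeq := lp (fun _ : Modes => EuclideanSpace ℂ (Fin 2)) 2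

/-- The wave vector `k = (2π/L) n`. -/
def wave (L : ℝ) (n : Modes) : EuclideanSpace ℝ (Fin 2) :=
  WithLp.toLp 2 fun j => 2 * Real.pi / L * (n j : ℝ)

/-! ### The spaces `H` and `V_α` and their norms -/

/-- The squared norm `‖U‖_α² = L² ∑_k |k|^{2α} |Û_k|²`, with values in `[0,∞]`, for scalar
and for vector valued Fourier coefficients. -/
def sobSq {E : Type*} [NormedAddCommGroup E] (L : ℝ) (α : ℕ) (c : Modes → E) : ℝ≥0∞ :=
  ENNReal.ofReal (L ^ 2) * ∑' n, ENNReal.ofReal (‖wave L n‖ ^ (2 * α) * ‖c n‖ ^ 2)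

/-- The norm `‖U‖_α` as a real number (meaningful when `sobSq` is finite). For velocities and
for vorticities, `|U| = ‖U‖_0`, `‖U‖ = ‖U‖_1` and `|AU| = ‖U‖_2`. -/
def sobNorm {E : Type*} [NormedAddCommGroup E] (L : ℝ) (α : ℕ) (c : Modes → E) : ℝ :=
  Real.sqrt (sobSq L α c).toReal

lemma sobSq_add_le {E : Type*} [NormedAddCommGroup E] (L : ℝ) (α : ℕ) (c d : Modes → E) :
    sobSq L α (c + d) ≤ 2 * sobSq L α c + 2 * sobSq L α d := by
  unfold sobSq
  rw [mul_left_comm, mul_left_comm (2 : ℝ≥0∞), ← mul_add]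
  refine mul_le_mul_right ?_ _
  rw [← ENNReal.tsum_mul_left, ← ENNReal.tsum_mul_left, ← ENNReal.tsum_add]
  refine ENNReal.tsum_le_tsum fun n => ?_
  have h2 : (2 : ℝ≥0∞) = ENNReal.ofReal 2 := by simp
  have h3 : ∀ r : ℝ, (2 : ℝ≥0∞) * ENNReal.ofReal r = ENNReal.ofReal (2 * r) := fun r => by
    rw [ENNReal.ofReal_mul (by norm_num), ← h2]
  rw [h3, h3, ← ENNReal.ofReal_add (by positivity) (by positivity)]
  apply ENNReal.ofReal_le_ofReal
  have h : ‖(c + d) n‖ ^ 2 ≤ 2 * ‖c n‖ ^ 2 + 2 * ‖d n‖ ^ 2 := by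
    have h1 : ‖(c + d) n‖ ≤ ‖c n‖ + ‖d n‖ := norm_add_le _ _
    nlinarith [norm_nonneg ((c + d) n), norm_nonneg (c n), norm_nonneg (d n),
      sq_nonneg (‖c n‖ - ‖d n‖)]
  calc _ ≤ ‖wave L n‖ ^ (2 * α) * (2 * ‖c n‖ ^ 2 + 2 * ‖d n‖ ^ 2) := by gcongr
    _ = _ := by ring

lemma sobSq_smul {E : Type*} [NormedAddCommGroup E] [NormedSpace ℝ E] (L : ℝ) (α : ℕ) (a : ℝ)
    (c : Modes → E) : sobSq L α (a • c) = ENNReal.ofReal (a ^ 2) * sobSq L α c := by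
  unfold sobSq
  rw [mul_left_comm]
  congr 1
  rw [← ENNReal.tsum_mul_left]
  refine tsum_congr fun n => ?_
  rw [← ENNReal.ofReal_mul (by positivity)]
  congr 1
  rw [Pi.smul_apply, norm_smul, mul_pow, Real.norm_eq_abs, sq_abs]
  ring

/-- The space `H`: square summable families with `conj Û_k = Û_{-k}` (the field is real),
`k · Û_k = 0` (it is divergence free) and `Û_0 = 0` (it has zero average). -/
def H (L : ℝ) : Submodule ℝ FourierSeq where
  carrier := {U | (∀ n j, conj (U n j) = U (-n) j) ∧
    (∀ n, ∑ j, (wave L n j : ℂ) * U n j = 0) ∧ U 0 = 0}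
  zero_mem' := by simp
  add_mem' := by
    rintro U W ⟨h1, h2, h3⟩ ⟨g1, g2, g3⟩
    refine ⟨fun n j => ?_, fun n => ?_, ?_⟩
    · simp [h1, g1]
    · simp only [lp.coeFn_add, Pi.add_apply, PiLp.add_apply, mul_add, Finset.sum_add_distrib,
        h2, g2, add_zero]
    · simp [h3, g3]
  smul_mem' := by
    rintro a U ⟨h1, h2, h3⟩
    refine ⟨fun n j => ?_, fun n => ?_, ?_⟩
    · simp [h1]
    · have := h2 n
      simp only [lp.coeFn_smul, Pi.smul_apply, PiLp.smul_apply, Complex.real_smul,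
        mul_left_comm _ (a : ℂ), ← Finset.mul_sum, this, mul_zero]
    · simp [h3]

/-- `V_α = {U ∈ H : ‖U‖_α < ∞}`. In particular `V = V_1` and `𝒟(A) = V_2`. -/
def Vsp (L : ℝ) (α : ℕ) : Submodule ℝ FourierSeq where
  carrier := {U | U ∈ H L ∧ sobSq L α U < ∞}
  zero_mem' := ⟨zero_mem _, by simp [sobSq]⟩
  add_mem' := by
    rintro U W ⟨h1, h2⟩ ⟨g1, g2⟩
    refine ⟨add_mem h1 g1, ?_⟩
    rw [lp.coeFn_add]
    refine (sobSq_add_le L α _ _).trans_lt ?_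
    exact ENNReal.add_lt_top.2 ⟨ENNReal.mul_lt_top (by simp) h2,
      ENNReal.mul_lt_top (by simp) g2⟩
  smul_mem' := by
    rintro a U ⟨h1, h2⟩
    refine ⟨Submodule.smul_mem _ a h1, ?_⟩
    rw [lp.coeFn_smul, sobSq_smul]
    exact ENNReal.mul_lt_top (by simp) h2

/-- `𝒟(A) = V_2`. -/
abbrev DA (L : ℝ) : Submodule ℝ FourierSeq := Vsp L 2

/-! ### Functions on the torus and differential operators -/

/-- The exponential `x ↦ e^{i k · x}`, `k = (2π/L) n`. -/
def expMode (L : ℝ) (n : Modes) : C(Torus L, ℂ) :=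
  ∏ j, (fourier (n j)).comp (ContinuousMap.eval j)

/-- The sum `∑_k c_k e^{i k · x}` of a Fourier series, taken in `L²(Ω)`. -/
def fourierSum (L : ℝ) [Fact (0 < L)] (c : Modes → ℂ) : Lp ℂ 2 (volume : Measure (Torus L)) :=
  ∑' n, c n • ContinuousMap.toLp 2 (volume : Measure (Torus L)) ℂ (expMode L n)

/-- The real function on `Ω` with Fourier coefficients `c`, where `conj c_k = c_{-k}`. -/
def realize (L : ℝ) [Fact (0 < L)] (c : Modes → ℂ) (x : Torus L) : ℝ := (fourierSum L c x).re

/-- The vector field on `Ω` with Fourier coefficients `U`. -/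
def vel (L : ℝ) [Fact (0 < L)] (U : Modes → EuclideanSpace ℂ (Fin 2)) (x : Torus L) :
    EuclideanSpace ℝ (Fin 2) :=
  WithLp.toLp 2 fun j => realize L (fun n => U n j) x

/-- The norm `‖U‖_{L^∞}`. -/
def supNorm (L : ℝ) [Fact (0 < L)] (U : Modes → EuclideanSpace ℂ (Fin 2)) : ℝ :=
  (eLpNorm (vel L U) ∞ (volume : Measure (Torus L))).toReal

/-- The Fourier coefficient `L⁻² ∫_Ω g(x) e^{-i k · x} dx` of a real function `g`. -/
def coeffOf (L : ℝ) [Fact (0 < L)] (g : Torus L → ℝ) (n : Modes) : ℂ :=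
  ((L ^ 2)⁻¹ : ℝ) * ∫ x, conj (expMode L n x) * (g x : ℂ)

/-- Fourier coefficients of `∂_j c`. -/
def pderiv (L : ℝ) (j : Fin 2) (c : Modes → ℂ) (n : Modes) : ℂ :=
  Complex.I * (wave L n j : ℂ) * c n

/-- Fourier coefficients of `A c = -Δ c` for a scalar `c`. -/
def negLap (L : ℝ) (c : Modes → ℂ) (n : Modes) : ℂ := ((‖wave L n‖ ^ 2 : ℝ) : ℂ) * c n

/-- Fourier coefficients of `curl U = ∂_1 U_2 - ∂_2 U_1`. -/
def curl (L : ℝ) (U : Modes → EuclideanSpace ℂ (Fin 2)) (n : Modes) : ℂ :=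
  pderiv L 0 (fun m => U m 1) n - pderiv L 1 (fun m => U m 0) n

/-- The function `(v · ∇) c` on `Ω`, for a velocity `v` and a scalar `c`. For a vorticity `ξ`
this is `B(v, ξ)`. -/
def advect (L : ℝ) [Fact (0 < L)] (v : Modes → EuclideanSpace ℂ (Fin 2)) (c : Modes → ℂ)
    (x : Torus L) : ℝ :=
  ∑ j, vel L v x j * realize L (pderiv L j c) x

/-- The integrand of the pairing `(B(v, η), A ξ)`. -/
def pairingDensity (L : ℝ) [Fact (0 < L)] (v : Modes → EuclideanSpace ℂ (Fin 2))
    (η ξ : Modes → ℂ) (x : Torus L) : ℝ :=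
  advect L v η x * realize L (negLap L ξ) x

/-- The `L²(Ω)` pairing `(B(v, η), A ξ)` of `(v · ∇) η` with `-Δ ξ`. -/
def pairing (L : ℝ) [Fact (0 < L)] (v : Modes → EuclideanSpace ℂ (Fin 2))
    (η ξ : Modes → ℂ) : ℝ :=
  ∫ x, pairingDensity L v η ξ x

/-- The bounds on the nonlinear vorticity terms for the velocities `U` and `v`, where
`W = curl U` and `ξ = curl v`. That the integrals defining the three pairings converge
absolutely is part of the claim. -/
def VorticityBounds (L : ℝ) [Fact (0 < L)] (ν C : ℝ)
    (U v : Modes → EuclideanSpace ℂ (Fin 2)) : Prop :=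
  (Integrable (pairingDensity L v (curl L U) (curl L v)) ∧
    |pairing L v (curl L U) (curl L v)| ≤
      C * (4 ^ 2 / (3 * ν ^ 2)) * sobNorm L 0 v ^ 2 * sobNorm L 1 (curl L U) ^ 3
        + ν / 6 * sobNorm L 2 (curl L v) ^ 2) ∧
  (Integrable (pairingDensity L v (curl L v) (curl L v)) ∧
    |pairing L v (curl L v) (curl L v)| ≤
      C * (4 ^ 2 / (3 * ν ^ 2)) * sobNorm L 0 v ^ 2 * sobNorm L 1 (curl L v) ^ 3
        + ν / 6 * sobNorm L 2 (curl L v) ^ 2) ∧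
  (Integrable (pairingDensity L U (curl L v) (curl L v)) ∧
    |pairing L U (curl L v) (curl L v)| ≤
      C * (5 ^ 5 / ν ^ 5) * supNorm L U ^ 6 * sobNorm L 0 v ^ 2
        + ν / 6 * sobNorm L 2 (curl L v) ^ 2)

/-! ### The Navier--Stokes equations -/

/-- The `k`-th coefficient of the projection of a vector field onto `H`, computed from its
`k`-th coefficient `a`: it is `a - k (k · a) / |k|²` for `k ≠ 0`, and `0` for `k = 0`. -/
def leray (L : ℝ) (n : Modes) (a : Fin 2 → ℂ) : EuclideanSpace ℂ (Fin 2) :=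
  if n = 0 then 0 else
    WithLp.toLp 2 fun i =>
      a i - (wave L n i : ℂ) * (∑ j, (wave L n j : ℂ) * a j) / ((‖wave L n‖ ^ 2 : ℝ) : ℂ)

/-- Fourier coefficients of `B(u, w) = P_σ((u · ∇) w)` for velocities `u` and `w`. -/
def nonlin (L : ℝ) [Fact (0 < L)] (u w : Modes → EuclideanSpace ℂ (Fin 2)) (n : Modes) :
    EuclideanSpace ℂ (Fin 2) :=
  leray L n fun i => coeffOf L (advect L u fun m => w m i) n

/-- `w` is a strong solution of `dw/dt + ν A w + B(w, w) = f` on `[s, ∞)`: it is continuous with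
values in `V`, locally square integrable with values in `𝒟(A)`, and satisfies the time integrated
equation tested with every Fourier mode. -/
structure IsStrongSolution (L : ℝ) [Fact (0 < L)] (ν : ℝ) (f : ℝ → H L) (s : ℝ)
    (w : ℝ → DA L) : Prop where
  continuous_V : ∀ t ≥ s, Tendsto (fun τ => sobSq L 1 (w τ - w t : FourierSeq)) (𝓝[Ici s] t) (𝓝 0)
  square_integrable : ∀ T ≥ s, ∫⁻ t in Icc s T, sobSq L 2 (w t : FourierSeq) < ∞
  equation : ∀ t ≥ s, ∀ (n : Modes) (i : Fin 2),
    (w t : FourierSeq) n i = (w s : FourierSeq) n i +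
      ∫ τ in s..t, ((f τ : FourierSeq) n i
        - ((ν * ‖wave L n‖ ^ 2 : ℝ) : ℂ) * (w τ : FourierSeq) n i
        - nonlin L (w τ : FourierSeq) (w τ : FourierSeq) n i)

/-! ### The data assimilation algorithm -/

/-- A type-II interpolant observable: a linear operator `I_h : 𝒟(A) → L²(Ω; ℝ²)` with
`‖U - I_h U‖²_{L²} ≤ c₁ h² (‖U‖² + h² |AU|²)`. -/
def IsTypeII (L : ℝ) [Fact (0 < L)] (h c₁ : ℝ)
    (Ih : DA L →ₗ[ℝ] Lp (EuclideanSpace ℝ (Fin 2)) 2 (volume : Measure (Torus L))) : Prop :=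
  ∀ U : DA L, ∫ x, ‖vel L (U : FourierSeq) x - Ih U x‖ ^ 2 ≤
    c₁ * h ^ 2 * (sobNorm L 1 (U : FourierSeq) ^ 2 + h ^ 2 * sobNorm L 2 (U : FourierSeq) ^ 2)

/-- The Fourier coefficients of `P_λ P_σ g` for a vector field `g` on `Ω`, where `P_λ` keeps the
modes with `|k|² ≤ λ`. -/
def filterCoeff (L : ℝ) [Fact (0 < L)] (lam : ℝ) (g : Torus L → EuclideanSpace ℝ (Fin 2))
    (n : Modes) : EuclideanSpace ℂ (Fin 2) :=
  open Classical in
  if ‖wave L n‖ ^ 2 ≤ lam then leray L n fun i => coeffOf L (fun x => g x i) n else 0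

lemma wave_neg (L : ℝ) (n : Modes) : wave L (-n) = -wave L n := by
  ext j; simp [wave]

lemma finite_wave_le (L : ℝ) (hL : 0 < L) (lam : ℝ) :
    {n : Modes | ‖wave L n‖ ^ 2 ≤ lam}.Finite := by
  have hc : 0 < 2 * Real.pi / L := by positivity
  set N : ℤ := ⌈lam / (2 * Real.pi / L) ^ 2⌉ with hN
  refine (Set.finite_Icc (fun _ => -N : Modes) (fun _ => N)).subset fun n hn => ?_
  have key : ∀ j, |n j| ≤ N := by
    intro j
    have h1 : (wave L n j) ^ 2 ≤ lam := by
      refine le_trans ?_ hn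
      rw [EuclideanSpace.norm_sq_eq, ← sq_abs (wave L n j), ← Real.norm_eq_abs]
      exact Finset.single_le_sum (f := fun i => ‖wave L n i‖ ^ 2) (fun i _ => by positivity)
        (Finset.mem_univ j)
    have h2 : ((n j : ℝ)) ^ 2 ≤ lam / (2 * Real.pi / L) ^ 2 := by
      rw [le_div_iff₀ (by positivity)]
      have : wave L n j = 2 * Real.pi / L * (n j : ℝ) := rfl
      rw [this] at h1
      linarith [mul_pow (2 * Real.pi / L) (n j : ℝ) 2]
    have h3 : (((n j) ^ 2 : ℤ) : ℝ) ≤ (N : ℝ) := by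
      push_cast
      exact h2.trans (Int.le_ceil _)
    have h4 : (n j) ^ 2 ≤ N := by exact_mod_cast h3
    refine le_trans ?_ h4
    rw [← sq_abs]
    exact Int.le_self_sq _
  exact ⟨fun j => (abs_le.1 (key j)).1, fun j => (abs_le.1 (key j)).2⟩

lemma filterCoeff_eq_zero (L : ℝ) [Fact (0 < L)] (lam : ℝ)
    (g : Torus L → EuclideanSpace ℝ (Fin 2)) (n : Modes)
    (hn : n ∉ (finite_wave_le L Fact.out lam).toFinset) : filterCoeff L lam g n = 0 := by
  have h : ¬ ‖wave L n‖ ^ 2 ≤ lam := by simpa using hn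
  simp [filterCoeff, h]

lemma expMode_neg (L : ℝ) (n : Modes) (x : Torus L) :
    expMode L (-n) x = conj (expMode L n x) := by
  simp [expMode]

lemma conj_coeffOf (L : ℝ) [Fact (0 < L)] (g : Torus L → ℝ) (n : Modes) :
    conj (coeffOf L g n) = coeffOf L g (-n) := by
  unfold coeffOf
  rw [map_mul, Complex.conj_ofReal, ← integral_conj]
  simp [expMode_neg]

lemma conj_leray (L : ℝ) (n : Modes) (a b : Fin 2 → ℂ) (hab : ∀ i, conj (a i) = b i)
    (i : Fin 2) : conj (leray L n a i) = leray L (-n) b i := by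
  unfold leray
  by_cases hn : n = 0
  · simp [hn]
  · simp [hn, wave_neg, hab]
    ring

lemma wave_ne_zero (L : ℝ) (hL : 0 < L) {n : Modes} (hn : n ≠ 0) : wave L n ≠ 0 := by
  intro h
  apply hn
  ext j
  have h1 : wave L n j = 0 := by rw [h]; rfl
  have h2 : 2 * Real.pi / L * (n j : ℝ) = 0 := h1
  have hc : 2 * Real.pi / L ≠ 0 := by positivity
  simpa [hc, hL.ne', Real.pi_ne_zero] using h2

lemma wave_inner_leray (L : ℝ) (hL : 0 < L) (n : Modes) (a : Fin 2 → ℂ) :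
    ∑ j, (wave L n j : ℂ) * leray L n a j = 0 := by
  unfold leray
  by_cases hn : n = 0
  · simp [hn]
  · have hw := wave_ne_zero L hL hn
    have h0 : ‖wave L n‖ ^ 2 ≠ 0 := by simpa using hw
    have h1 : ‖wave L n‖ ^ 2 = wave L n 0 ^ 2 + wave L n 1 ^ 2 := by
      simp [EuclideanSpace.norm_sq_eq]
    rw [h1] at h0
    have h2 : ((wave L n 0 : ℂ) ^ 2 + (wave L n 1 : ℂ) ^ 2) ≠ 0 := by exact_mod_cast h0
    simp only [if_neg hn, h1, Fin.sum_univ_two]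
    push_cast
    field_simp
    ring

/-- The operator `g ↦ P_λ P_σ g`, with values in `𝒟(A)`. -/
def filterProj (L : ℝ) [Fact (0 < L)] (lam : ℝ) (g : Torus L → EuclideanSpace ℝ (Fin 2)) :
    DA L :=
  ⟨⟨filterCoeff L lam g, by
      refine memℓp_gen (summable_of_ne_finset_zero
        (s := (finite_wave_le L Fact.out lam).toFinset) fun n hn => ?_)
      simp [filterCoeff_eq_zero L lam g n hn]⟩, by
    refine ⟨⟨fun n j => ?_, fun n => ?_, ?_⟩, ?_⟩
    · change conj (filterCoeff L lam g n j) = filterCoeff L lam g (-n) j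
      unfold filterCoeff
      rw [wave_neg, norm_neg]
      split_ifs
      · exact conj_leray L n _ _ (fun i => conj_coeffOf L _ n) j
      · simp
    · change ∑ j, (wave L n j : ℂ) * filterCoeff L lam g n j = 0
      unfold filterCoeff
      split_ifs
      · exact wave_inner_leray L Fact.out n _
      · simp
    · change filterCoeff L lam g 0 = 0
      simp [filterCoeff, leray]
    · change sobSq L 2 (filterCoeff L lam g) < ∞
      unfold sobSq
      rw [tsum_eq_sum (s := (finite_wave_le L Fact.out lam).toFinset) fun n hn => by
        simp [filterCoeff_eq_zero L lam g n hn]]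
      exact ENNReal.mul_lt_top (by simp) (ENNReal.sum_lt_top.2 fun n _ => ENNReal.ofReal_lt_top)⟩

/-- The operator `J = P_λ P_σ I_h` on `𝒟(A)`. -/
def obsJ (L : ℝ) [Fact (0 < L)] (lam : ℝ)
    (Ih : DA L →ₗ[ℝ] Lp (EuclideanSpace ℝ (Fin 2)) 2 (volume : Measure (Torus L)))
    (U : DA L) : DA L :=
  filterProj L lam (Ih U)

/-- The operator `E = I - J` on `𝒟(A)`. -/
def obsE (L : ℝ) [Fact (0 < L)] (lam : ℝ)
    (Ih : DA L →ₗ[ℝ] Lp (EuclideanSpace ℝ (Fin 2)) 2 (volume : Measure (Torus L)))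
    (U : DA L) : DA L :=
  U - obsJ L lam Ih U

/-- `u` is the spectrally-filtered discrete-in-time downscaling data assimilation process for the
exact solution `U` and the observation times `t_n = t₀ + n δ`. Here `w n = S(·, t_n; u_n)` is the
solution that starts at time `t_n` from `u_n`, so that `u_n = w n t_n`. -/
def IsAssimilation (L : ℝ) [Fact (0 < L)] (ν : ℝ) (f : ℝ → H L) (t₀ δ lam : ℝ)
    (Ih : DA L →ₗ[ℝ] Lp (EuclideanSpace ℝ (Fin 2)) 2 (volume : Measure (Torus L)))
    (U u : ℝ → DA L) : Prop :=
  ∃ w : ℕ → ℝ → DA L,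
    (∀ n : ℕ, IsStrongSolution L ν f (t₀ + n * δ) (w n)) ∧
    w 0 t₀ = obsJ L lam Ih (U t₀) ∧
    (∀ n : ℕ, w (n + 1) (t₀ + (n + 1 : ℕ) * δ) =
      obsE L lam Ih (w n (t₀ + (n + 1 : ℕ) * δ)) + obsJ L lam Ih (U (t₀ + (n + 1 : ℕ) * δ))) ∧
    (∀ n : ℕ, ∀ t ∈ Ico (t₀ + n * δ) (t₀ + (n + 1 : ℕ) * δ), u t = w n t)

end NSE
end

namespace NSE

/-! ### Sobolev norms as real sums -/

section Sobolev

variable {E : Type*} [NormedAddCommGroup E] {L : ℝ} {α : ℕ} {c : Modes → E}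

/-! For (a), Hölder's inequality in L^∞ · L² · L² bounds each pairing by `2 M ‖η‖ |Aξ|`, where `M`
dominates the components of the advecting field (`integrable_pairingDensity_and_abs_pairing_le`).
Since `v` is divergence free, `‖ξ‖_α = ‖v‖_{α+1}` (`sobNorm_curl`), so everything is measured by `a
= |v|` and `b = |Aξ| = ‖v‖_3`.

Fractional exponents are avoided through the length `τ` with `a = τ³ b`. Agmon's inequality becomes
`∑ |v_k| ≤ 3 τ² b` (`tsum_norm_le`) and interpolation becomes `‖ξ‖² ≤ 2 τ² b²`
(`sobNorm_two_sq_le`). The first two pairings are then at most `6 y b²` with `y = τ² ‖η‖`, the third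
at most `3 y b²` with `y = ‖U‖_{L^∞} τ`. Young's inequality, with power 3 or 6 of `y`, gives the
claim because `τ⁶ b² = a²`. The constants do not see `L`: Poincaré's inequality gives `2πτ/L ≤ 1`,
which makes the lattice sum in Agmon's inequality comparable to an integral.

For (b), a measurable function with finite integral is finite almost everywhere. Measurability of `t
↦ ‖w(t)‖_3²` follows from continuity of each Fourier mode, and countably many time intervals cover
almost every `t`. There (a) applies to `U(t)` and `v(t)`. -/

lemma sobNorm_nonneg : 0 ≤ sobNorm L α c := Real.sqrt_nonneg _

lemma sobSq_lt_top_iff (hL : 0 < L) :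
    sobSq L α c < ∞ ↔ Summable fun n => ‖wave L n‖ ^ (2 * α) * ‖c n‖ ^ 2 := by
  have h0 : ENNReal.ofReal (L ^ 2) ≠ 0 := by simpa using hL.ne'
  unfold sobSq
  constructor
  · intro h
    have h1 : (∑' n, ENNReal.ofReal (‖wave L n‖ ^ (2 * α) * ‖c n‖ ^ 2)) ≠ ∞ := by
      intro h2
      rw [h2, ENNReal.mul_top h0] at h
      exact lt_irrefl _ h
    refine (ENNReal.summable_toReal h1).congr fun n => ?_
    exact ENNReal.toReal_ofReal (by positivity)
  · intro h
    rw [← ENNReal.ofReal_tsum_of_nonneg (fun n => by positivity) h]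
    exact ENNReal.mul_lt_top ENNReal.ofReal_lt_top ENNReal.ofReal_lt_top

lemma sobNorm_sq : sobNorm L α c ^ 2 = L ^ 2 * ∑' n, ‖wave L n‖ ^ (2 * α) * ‖c n‖ ^ 2 := by
  rw [sobNorm, Real.sq_sqrt ENNReal.toReal_nonneg, sobSq, ENNReal.toReal_mul,
    ENNReal.toReal_ofReal (sq_nonneg L), ENNReal.tsum_toReal_eq fun _ => ENNReal.ofReal_ne_top]
  congr 1
  exact tsum_congr fun n => ENNReal.toReal_ofReal (by positivity)

lemma sobSq_zero_lt_top (hL : 0 < L) (U : FourierSeq) : sobSq L 0 U < ∞ := by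
  rw [sobSq_lt_top_iff hL]
  have := (lp.memℓp U).summable (by norm_num)
  simpa using this

lemma wave_norm_sq (n : Modes) :
    ‖wave L n‖ ^ 2 = (2 * Real.pi / L) ^ 2 * ((n 0 : ℝ) ^ 2 + (n 1 : ℝ) ^ 2) := by
  simp only [EuclideanSpace.norm_sq_eq, Fin.sum_univ_two, wave, Real.norm_eq_abs, sq_abs]
  ring

lemma le_wave_norm_sq {n : Modes} (hn : n ≠ 0) : (2 * Real.pi / L) ^ 2 ≤ ‖wave L n‖ ^ 2 := by
  rw [wave_norm_sq]
  refine le_mul_of_one_le_right (sq_nonneg _) ?_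
  have h : (1 : ℤ) ≤ n 0 ^ 2 + n 1 ^ 2 := by
    by_contra! h
    have h0 : n 0 = 0 := by nlinarith [sq_nonneg (n 0), sq_nonneg (n 1)]
    have h1 : n 1 = 0 := by nlinarith [sq_nonneg (n 0), sq_nonneg (n 1)]
    exact hn (by ext j; fin_cases j <;> simp [h0, h1])
  exact_mod_cast h

end Sobolev

/-- Lagrange's identity `|k^⊥ · a|² + |k · a|² = |k|² |a|²`, whose second term vanishes by
incompressibility. -/
lemma norm_curl_sq {L : ℝ} {U : FourierSeq} (hU : U ∈ H L) (n : Modes) :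
    ‖curl L U n‖ ^ 2 = ‖wave L n‖ ^ 2 * ‖U n‖ ^ 2 := by
  have h := hU.2.1 n
  rw [Fin.sum_univ_two] at h
  have hre := congrArg Complex.re h
  have him := congrArg Complex.im h
  simp only [Complex.add_re, Complex.add_im, Complex.mul_re, Complex.mul_im, Complex.ofReal_re,
    Complex.ofReal_im, zero_mul, sub_zero, add_zero, Complex.zero_re, Complex.zero_im] at hre him
  simp only [curl, pderiv, EuclideanSpace.norm_sq_eq, Fin.sum_univ_two, Complex.sq_norm,
    Complex.normSq_apply, Complex.sub_re, Complex.sub_im, Complex.mul_re, Complex.mul_im,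
    Complex.ofReal_re, Complex.ofReal_im, Complex.I_re, Complex.I_im, Real.norm_eq_abs, sq_abs]
  linear_combination
    -(wave L n 0 * (U n 0).re + wave L n 1 * (U n 1).re) * hre -
    (wave L n 0 * (U n 0).im + wave L n 1 * (U n 1).im) * him

lemma sobSq_curl {L : ℝ} {U : FourierSeq} (hU : U ∈ H L) (α : ℕ) :
    sobSq L α (curl L U) = sobSq L (α + 1) U := by
  unfold sobSq
  congr 1
  refine tsum_congr fun n => ?_
  rw [norm_curl_sq hU]
  congr 1
  ring

lemma sobNorm_curl {L : ℝ} {U : FourierSeq} (hU : U ∈ H L) (α : ℕ) :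
    sobNorm L α (curl L U) = sobNorm L (α + 1) U := by
  rw [sobNorm, sobSq_curl hU, sobNorm]

/-! ### Agmon's inequality -/

/-- With `x = t(m+1)`, `1 + x² ≥ (1+x)²/2 ≥ (1 + t(m+1))(1 + tm)/2`, and the reciprocal of the last
product telescopes. -/
lemma sum_range_inv_one_add_sq_le {t : ℝ} (ht : 0 < t) (N : ℕ) :
    ∑ m ∈ Finset.range N, (1 + t ^ 2 * ((m : ℝ) + 1) ^ 2)⁻¹ ≤ 2 / t := by
  have key : ∀ m ∈ Finset.range N, (1 + t ^ 2 * ((m : ℝ) + 1) ^ 2)⁻¹ ≤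
      (-(2 / (t * (1 + t * ((m + 1 : ℕ) : ℝ))))) - (-(2 / (t * (1 + t * (m : ℝ))))) := by
    intro m _
    have hm : (0 : ℝ) ≤ m := m.cast_nonneg
    have h1 : (-(2 / (t * (1 + t * ((m + 1 : ℕ) : ℝ))))) - (-(2 / (t * (1 + t * (m : ℝ))))) =
        2 / ((1 + t * (m + 1)) * (1 + t * m)) := by
      push_cast
      field_simp
      ring
    rw [h1, inv_eq_one_div, div_le_div_iff₀ (by positivity) (by positivity)]
    nlinarith [sq_nonneg (1 - t * (m + 1)), mul_nonneg ht.le hm]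
  refine (Finset.sum_le_sum key).trans ?_
  rw [Finset.sum_range_sub (fun m : ℕ => -(2 / (t * (1 + t * (m : ℝ)))))]
  have : 0 ≤ 2 / (t * (1 + t * (N : ℝ))) := by positivity
  simp only [Nat.cast_zero, mul_zero, add_zero, mul_one]
  linarith

lemma hasSum_inv_one_add_sq_le {t : ℝ} (ht : 0 < t) (ht1 : t ≤ 1) :
    ∃ S, HasSum (fun m : ℤ => (1 + t ^ 2 * (m : ℝ) ^ 2)⁻¹) S ∧ S ≤ 5 / t := by
  have hs : Summable fun m : ℕ => (1 + t ^ 2 * ((m : ℝ) + 1) ^ 2)⁻¹ :=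
    summable_of_sum_range_le (fun _ => by positivity) (sum_range_inv_one_add_sq_le ht)
  have hle := hs.tsum_le_of_sum_range_le (sum_range_inv_one_add_sq_le ht)
  have hsum := HasSum.of_add_one_of_neg_add_one (f := fun m : ℤ => (1 + t ^ 2 * (m : ℝ) ^ 2)⁻¹)
    (by simpa using hs.hasSum) (by convert hs.hasSum using 3 with m; push_cast; ring)
  refine ⟨_, hsum, ?_⟩
  -- The term `m = 0` equals 1 for every `t`; it is absorbed into `1/t` only because `t ≤ 1`. Each
  -- half-line contributes `2/t`.
  have h1 : 1 ≤ 1 / t := by rw [le_div_iff₀ ht]; linarith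
  have h2 : 5 / t = 2 / t + 1 / t + 2 / t := by ring
  simp only [Int.cast_zero]
  norm_num
  linarith [h1, one_div t]

lemma hasSum_inv_weight_le {t : ℝ} (ht : 0 < t) (ht1 : t ≤ 1) :
    ∃ S, HasSum (fun n : Modes =>
      ((1 + t ^ 2 * (n 0 : ℝ) ^ 2) * (1 + t ^ 2 * (n 1 : ℝ) ^ 2))⁻¹) S ∧ S ≤ 25 / t ^ 2 := by
  obtain ⟨S, hS, hle⟩ := hasSum_inv_one_add_sq_le ht ht1
  have h0 : 0 ≤ S := hS.nonneg fun _ => by positivity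
  refine ⟨S * S, ?_, ?_⟩
  · have hp : HasSum (fun p : ℤ × ℤ =>
        (1 + t ^ 2 * (p.1 : ℝ) ^ 2)⁻¹ * (1 + t ^ 2 * (p.2 : ℝ) ^ 2)⁻¹) (S * S) :=
      hS.mul hS (hS.summable.mul_of_nonneg hS.summable (fun _ => by positivity)
        fun _ => by positivity)
    convert (finTwoArrowEquiv ℤ).hasSum_iff.2 hp using 2 with n
    simp [mul_comm]
  · calc S * S ≤ (5 / t) * (5 / t) := by gcongr
      _ = 25 / t ^ 2 := by ring

/-- A weighted Cauchy--Schwarz bound for the sum of the Fourier coefficients. -/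
lemma summable_norm_of_weight {E : Type*} [NormedAddCommGroup E] {L : ℝ} (hL : 0 < L)
    {c : Modes → E} {τ : ℝ} (hτ : 0 < τ) (hτ1 : 2 * Real.pi / L * τ ≤ 1)
    (hc : Summable fun n => (1 + τ ^ 2 * ‖wave L n‖ ^ 2) ^ 2 * ‖c n‖ ^ 2) :
    (Summable fun n => ‖c n‖) ∧ (∑' n, ‖c n‖) ^ 2 ≤
      25 / (2 * Real.pi / L * τ) ^ 2 *
        ∑' n, (1 + τ ^ 2 * ‖wave L n‖ ^ 2) ^ 2 * ‖c n‖ ^ 2 := by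
  set t := 2 * Real.pi / L * τ with ht
  have ht0 : 0 < t := by positivity
  obtain ⟨S, hS, hle⟩ := hasSum_inv_weight_le ht0 hτ1
  set T := ∑' n, (1 + τ ^ 2 * ‖wave L n‖ ^ 2) ^ 2 * ‖c n‖ ^ 2
  have hT : 0 ≤ T := tsum_nonneg fun n => by positivity
  have key : ∀ s : Finset Modes, ∑ n ∈ s, ‖c n‖ ≤ Real.sqrt (25 / t ^ 2 * T) := by
    intro s
    apply Real.le_sqrt_of_sq_le
    refine (Finset.sum_sq_le_sum_mul_sum_of_sq_le_mul s
      (f := fun n => ((1 + t ^ 2 * (n 0 : ℝ) ^ 2) * (1 + t ^ 2 * (n 1 : ℝ) ^ 2))⁻¹)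
      (g := fun n => ((1 + t ^ 2 * (n 0 : ℝ) ^ 2) * (1 + t ^ 2 * (n 1 : ℝ) ^ 2)) * ‖c n‖ ^ 2)
      (fun n _ => by positivity) (fun n _ => by positivity) (fun n _ => ?_)).trans ?_
    · have : (1 + t ^ 2 * (n 0 : ℝ) ^ 2) * (1 + t ^ 2 * (n 1 : ℝ) ^ 2) ≠ 0 := by positivity
      rw [inv_mul_cancel_left₀ this]
    · refine mul_le_mul ((sum_le_hasSum s (fun n _ => by positivity) hS).trans hle) ?_
        (Finset.sum_nonneg fun n _ => by positivity) (by positivity)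
      refine le_trans (Finset.sum_le_sum fun n _ => ?_)
        (hc.sum_le_tsum s fun n _ => by positivity)
      gcongr
      -- The product weight, whose reciprocal sum factors over the two coordinates, lies below the
      -- isotropic weight `(1 + τ²|k|²)²`.
      have h : τ ^ 2 * ‖wave L n‖ ^ 2 = t ^ 2 * (n 0 : ℝ) ^ 2 + t ^ 2 * (n 1 : ℝ) ^ 2 := by
        rw [wave_norm_sq, ht]
        ring
      rw [h, sq (1 + _)]
      gcongr
      · have : 0 ≤ t ^ 2 * (n 1 : ℝ) ^ 2 := by positivity
        linarith
      · have : 0 ≤ t ^ 2 * (n 0 : ℝ) ^ 2 := by positivity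
        linarith
  have hs : Summable fun n => ‖c n‖ := summable_of_sum_le (fun n => norm_nonneg _) key
  refine ⟨hs, ?_⟩
  have h1 := hs.tsum_le_of_sum_le key
  calc _ ≤ Real.sqrt (25 / t ^ 2 * T) ^ 2 := by
        gcongr
    _ = _ := Real.sq_sqrt (by positivity)

lemma summable_norm_of_sobSq_two {E : Type*} [NormedAddCommGroup E] {L : ℝ} (hL : 0 < L)
    {c : Modes → E} (h0 : sobSq L 0 c < ∞) (h2 : sobSq L 2 c < ∞) :
    Summable fun n => ‖c n‖ := by
  rw [sobSq_lt_top_iff hL] at h0 h2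
  have hk : 2 * Real.pi / L * (L / (2 * Real.pi)) = 1 := by
    field_simp
  refine (summable_norm_of_weight hL (τ := L / (2 * Real.pi)) (by positivity) hk.le ?_).1
  refine Summable.of_nonneg_of_le (fun n => by positivity) (fun n => ?_)
    ((h0.mul_left 2).add (h2.mul_left (2 * (L / (2 * Real.pi)) ^ 4)))
  have : (1 + (L / (2 * Real.pi)) ^ 2 * ‖wave L n‖ ^ 2) ^ 2 ≤
      2 + 2 * (L / (2 * Real.pi)) ^ 4 * ‖wave L n‖ ^ 4 := by
    nlinarith [sq_nonneg (1 - (L / (2 * Real.pi)) ^ 2 * ‖wave L n‖ ^ 2)]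
  calc _ ≤ (2 + 2 * (L / (2 * Real.pi)) ^ 4 * ‖wave L n‖ ^ 4) * ‖c n‖ ^ 2 := by gcongr
    _ = _ := by ring

section Interpolation

variable {E : Type*} [NormedAddCommGroup E] {L : ℝ} {c : Modes → E}

lemma sobSq_two_lt_top (hL : 0 < L) (h0 : sobSq L 0 c < ∞) (h3 : sobSq L 3 c < ∞) :
    sobSq L 2 c < ∞ := by
  rw [sobSq_lt_top_iff hL] at *
  refine Summable.of_nonneg_of_le (fun n => by positivity) (fun n => ?_) (h0.add h3)
  have : ‖wave L n‖ ^ (2 * 2) ≤ 1 + ‖wave L n‖ ^ (2 * 3) := by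
    rcases le_total ‖wave L n‖ 1 with h | h
    · have := pow_le_one₀ (n := 2 * 2) (norm_nonneg _) h
      have : 0 ≤ ‖wave L n‖ ^ (2 * 3) := by positivity
      linarith
    · have := pow_le_pow_right₀ h (show 2 * 2 ≤ 2 * 3 by norm_num)
      linarith
  calc _ ≤ (1 + ‖wave L n‖ ^ (2 * 3)) * ‖c n‖ ^ 2 := by gcongr
    _ = _ := by ring

/-- The interpolation inequality `‖c‖_2 ≤ C ‖c‖_0^{1/3} ‖c‖_3^{2/3}`, in terms of the length
`τ` with `‖c‖_0 = τ³ ‖c‖_3`. -/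
lemma sobNorm_two_sq_le (hL : 0 < L) (h0 : sobSq L 0 c < ∞) (h3 : sobSq L 3 c < ∞)
    {τ : ℝ} (hτ : 0 < τ) (hab : sobNorm L 0 c = τ ^ 3 * sobNorm L 3 c) :
    sobNorm L 2 c ^ 2 ≤ 2 * τ ^ 2 * sobNorm L 3 c ^ 2 := by
  have h2 := sobSq_two_lt_top hL h0 h3
  have ha : sobNorm L 0 c ^ 2 = τ ^ 6 * sobNorm L 3 c ^ 2 := by rw [hab]; ring
  rw [sobSq_lt_top_iff hL] at *
  suffices h : sobNorm L 2 c ^ 2 ≤ (τ ^ 4)⁻¹ * sobNorm L 0 c ^ 2 + τ ^ 2 * sobNorm L 3 c ^ 2 by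
    rw [ha] at h
    refine h.trans_eq ?_
    field_simp
    ring
  rw [sobNorm_sq, sobNorm_sq, sobNorm_sq, mul_left_comm _ (L ^ 2), mul_left_comm (τ ^ 2),
    ← mul_add, ← tsum_mul_left (a := (τ ^ 4)⁻¹), ← tsum_mul_left (a := τ ^ 2),
    ← (h0.mul_left _).tsum_add (h3.mul_left _)]
  refine mul_le_mul_of_nonneg_left
    (h2.tsum_le_tsum (fun n => ?_) ((h0.mul_left _).add (h3.mul_left _))) (sq_nonneg L)
  have : ‖wave L n‖ ^ (2 * 2) ≤ (τ ^ 4)⁻¹ + τ ^ 2 * ‖wave L n‖ ^ (2 * 3) := by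
    -- Low modes are controlled by `τ⁻⁴`, high modes by `τ²|k|⁶`; the choice of `τ` makes the two
    -- resulting sums equal.
    rcases le_total (τ * ‖wave L n‖) 1 with h | h
    · have h4 := pow_le_one₀ (n := 4) (by positivity) h
      have h5 : ‖wave L n‖ ^ (2 * 2) ≤ (τ ^ 4)⁻¹ := by
        rw [inv_eq_one_div, le_div_iff₀ (by positivity)]
        calc _ = (τ * ‖wave L n‖) ^ 4 := by ring
          _ ≤ 1 := h4
      exact h5.trans (le_add_of_nonneg_right (by positivity))
    · have h4 := one_le_pow₀ (n := 2) h
      calc _ = ‖wave L n‖ ^ (2 * 2) * 1 := (mul_one _).symm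
        _ ≤ ‖wave L n‖ ^ (2 * 2) * (τ * ‖wave L n‖) ^ 2 := by gcongr
        _ = τ ^ 2 * ‖wave L n‖ ^ (2 * 3) := by ring
        _ ≤ _ := le_add_of_nonneg_left (by positivity)
  calc _ ≤ ((τ ^ 4)⁻¹ + τ ^ 2 * ‖wave L n‖ ^ (2 * 3)) * ‖c n‖ ^ 2 := by gcongr
    _ = _ := by ring

/-- Poincaré's inequality: zero average leaves only modes with `|k| ≥ 2π/L`. -/
lemma mul_sobNorm_zero_le (hL : 0 < L) (hc : c 0 = 0) (h0 : sobSq L 0 c < ∞)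
    (h3 : sobSq L 3 c < ∞) : (2 * Real.pi / L) ^ 3 * sobNorm L 0 c ≤ sobNorm L 3 c := by
  rw [sobSq_lt_top_iff hL] at *
  refine (sq_le_sq₀ (by have := sobNorm_nonneg (L := L) (α := 0) (c := c); positivity)
    sobNorm_nonneg).1 ?_
  rw [mul_pow, sobNorm_sq, sobNorm_sq, mul_left_comm, ← tsum_mul_left]
  refine mul_le_mul_of_nonneg_left
    ((h0.mul_left _).tsum_le_tsum (fun n => ?_) h3) (sq_nonneg L)
  by_cases hn : n = 0
  · simp [hn, hc]
  · have := pow_le_pow_left₀ (sq_nonneg _) (le_wave_norm_sq (L := L) hn) 3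
    rw [mul_zero, pow_zero, one_mul]
    gcongr
    calc _ = ((2 * Real.pi / L) ^ 2) ^ 3 := by ring
      _ ≤ _ := this
      _ = _ := by ring

/-- Agmon's inequality `‖c‖_{L^∞} ≤ C ‖c‖_0^{2/3} ‖c‖_3^{1/3}`, in terms of the length `τ` with
`‖c‖_0 = τ³ ‖c‖_3`. -/
lemma tsum_norm_le (hL : 0 < L) (hc : c 0 = 0) (h0 : sobSq L 0 c < ∞)
    (h3 : sobSq L 3 c < ∞) {τ : ℝ} (hτ : 0 < τ) (hb : 0 < sobNorm L 3 c)
    (hab : sobNorm L 0 c = τ ^ 3 * sobNorm L 3 c) :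
    ∑' n, ‖c n‖ ≤ 3 * τ ^ 2 * sobNorm L 3 c := by
  have ha : sobNorm L 0 c ^ 2 = τ ^ 6 * sobNorm L 3 c ^ 2 := by rw [hab]; ring
  have hτ1 : 2 * Real.pi / L * τ ≤ 1 := by
    have h := mul_sobNorm_zero_le hL hc h0 h3
    rw [hab] at h
    have h1 : (2 * Real.pi / L * τ) ^ 3 ≤ 1 := by
      refine le_of_mul_le_mul_right ?_ hb
      calc _ = (2 * Real.pi / L) ^ 3 * (τ ^ 3 * sobNorm L 3 c) := by ring
        _ ≤ _ := by linarith
    exact (pow_le_one_iff_of_nonneg (by positivity) (by norm_num)).1 h1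
  rw [sobSq_lt_top_iff hL] at *
  have hle : ∀ n, (1 + τ ^ 2 * ‖wave L n‖ ^ 2) ^ 2 * ‖c n‖ ^ 2 ≤
      4 * (‖wave L n‖ ^ (2 * 0) * ‖c n‖ ^ 2) + 4 * τ ^ 6 * (‖wave L n‖ ^ (2 * 3) * ‖c n‖ ^ 2) := by
    intro n
    have hx : 0 ≤ τ ^ 2 * ‖wave L n‖ ^ 2 := by positivity
    -- Trades the weight for the two norms `‖·‖_0` and `‖·‖_3`, whose contributions balance because
    -- `a² = τ⁶ b²`.
    have : (1 + τ ^ 2 * ‖wave L n‖ ^ 2) ^ 2 ≤ 4 + 4 * (τ ^ 2 * ‖wave L n‖ ^ 2) ^ 3 := by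
      nlinarith [mul_nonneg hx (sq_nonneg (τ ^ 2 * ‖wave L n‖ ^ 2 - 1)),
        sq_nonneg (τ ^ 2 * ‖wave L n‖ ^ 2 - 1)]
    calc _ ≤ (4 + 4 * (τ ^ 2 * ‖wave L n‖ ^ 2) ^ 3) * ‖c n‖ ^ 2 := by gcongr
      _ = _ := by ring
  have hs4 := (h0.mul_left 4).add (h3.mul_left (4 * τ ^ 6))
  have hs := Summable.of_nonneg_of_le (fun n => by positivity) hle hs4
  have h1 := (summable_norm_of_weight hL hτ hτ1 hs).2
  have h2 := hs.tsum_le_tsum hle hs4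
  rw [(h0.mul_left 4).tsum_add (h3.mul_left (4 * τ ^ 6)), tsum_mul_left, tsum_mul_left] at h2
  have h3' : L ^ 2 * (∑' n, (1 + τ ^ 2 * ‖wave L n‖ ^ 2) ^ 2 * ‖c n‖ ^ 2) ≤
      8 * τ ^ 6 * sobNorm L 3 c ^ 2 := by
    calc _ ≤ _ := mul_le_mul_of_nonneg_left h2 (sq_nonneg L)
      _ = 4 * sobNorm L 0 c ^ 2 + 4 * τ ^ 6 * sobNorm L 3 c ^ 2 := by
        rw [sobNorm_sq, sobNorm_sq]; ring
      _ = _ := by rw [ha]; ring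
  refine (sq_le_sq₀ (tsum_nonneg fun n => norm_nonneg _) (by positivity)).1 ?_
  calc _ ≤ _ := h1
    _ = 25 / (2 * Real.pi * τ) ^ 2 *
        (L ^ 2 * ∑' n, (1 + τ ^ 2 * ‖wave L n‖ ^ 2) ^ 2 * ‖c n‖ ^ 2) := by
      field_simp
    _ ≤ 25 / (2 * Real.pi * τ) ^ 2 * (8 * τ ^ 6 * sobNorm L 3 c ^ 2) := by gcongr
    _ = 50 / Real.pi ^ 2 * (τ ^ 4 * sobNorm L 3 c ^ 2) := by field_simp; ring
    _ ≤ 9 * (τ ^ 4 * sobNorm L 3 c ^ 2) := by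
      gcongr
      rw [div_le_iff₀ (by positivity)]
      nlinarith [Real.pi_gt_three]
    _ = _ := by ring

end Interpolation

/-! ### Fourier series on the torus -/

lemma norm_expMode_apply {L : ℝ} (n : Modes) (x : Torus L) : ‖expMode L n x‖ = 1 := by
  have h : ∀ (m : ℤ) (y : AddCircle L), ‖fourier m y‖ = 1 := fun m y => Circle.norm_coe _
  simp only [expMode, ContinuousMap.prod_apply, ContinuousMap.comp_apply, norm_prod, h,
    Finset.prod_const_one]

section FourierSeries

variable {L : ℝ} [Fact (0 < L)]

lemma norm_expMode_le (n : Modes) : ‖expMode L n‖ ≤ 1 :=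
  (ContinuousMap.norm_le _ zero_le_one).2 fun x => (norm_expMode_apply n x).le

lemma integral_fourier_mul_conj (m n : ℤ) :
    ∫ x : AddCircle L, fourier n x * conj (fourier m x) = if m = n then (L : ℂ) else 0 := by
  have hL : (L : ℂ) ≠ 0 := by exact_mod_cast (Fact.out : 0 < L).ne'
  have h := orthonormal_iff_ite.1 (orthonormal_fourier (T := L)) m n
  rw [fourierLp, fourierLp, ContinuousMap.inner_toLp, AddCircle.integral_haarAddCircle] at h
  rw [Complex.real_smul, Complex.ofReal_inv, inv_mul_eq_iff_eq_mul₀ hL] at h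
  rw [h]
  split_ifs <;> simp

/-- By Fubini the integral factors into circle integrals. The measure is not normalized, so each
diagonal factor is `L`. -/
lemma inner_expMode (m n : Modes) :
    inner ℂ (ContinuousMap.toLp 2 (volume : Measure (Torus L)) ℂ (expMode L m))
      (ContinuousMap.toLp 2 (volume : Measure (Torus L)) ℂ (expMode L n)) =
      if m = n then (L : ℂ) ^ 2 else 0 := by
  rw [ContinuousMap.inner_toLp]
  have h : ∀ x : Torus L, expMode L n x * conj (expMode L m x) =
      ∏ j, fourier (n j) (x j) * conj (fourier (m j) (x j)) := by
    intro x
    simp [expMode]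
    ring
  simp_rw [h]
  rw [integral_fintype_prod_volume_eq_prod
    (fun (j : Fin 2) (y : AddCircle L) => fourier (n j) y * conj (fourier (m j) y))]
  simp_rw [integral_fourier_mul_conj]
  split_ifs with hmn
  · simp [hmn]
  · obtain ⟨i, hi⟩ := Function.ne_iff.mp hmn
    exact Finset.prod_eq_zero (Finset.mem_univ i) (if_neg hi)

lemma norm_sum_expMode_sq (c : Modes → ℂ) (s : Finset Modes) :
    ‖∑ n ∈ s, c n • ContinuousMap.toLp 2 (volume : Measure (Torus L)) ℂ (expMode L n)‖ ^ 2 =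
      L ^ 2 * ∑ n ∈ s, ‖c n‖ ^ 2 := by
  have h := inner_self_eq_norm_sq_to_K (𝕜 := ℂ)
    (∑ n ∈ s, c n • ContinuousMap.toLp 2 (volume : Measure (Torus L)) ℂ (expMode L n))
  simp only [sum_inner, inner_sum, inner_smul_left, inner_smul_right, inner_expMode, mul_ite,
    mul_zero, Finset.sum_ite_eq'] at h
  have h2 : ((‖∑ n ∈ s, c n •
      ContinuousMap.toLp 2 (volume : Measure (Torus L)) ℂ (expMode L n)‖ ^ 2 : ℝ) : ℂ) =
      ((L ^ 2 * ∑ n ∈ s, ‖c n‖ ^ 2 : ℝ) : ℂ) := by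
    push_cast
    rw [Finset.mul_sum]
    refine h.symm.trans (Finset.sum_congr rfl fun n hn => ?_)
    simp only [hn, if_true]
    rw [mul_left_comm, ← mul_assoc, mul_comm, ← Complex.mul_conj']
    ring
  exact_mod_cast h2

lemma norm_fourierSum_sq_le {c : Modes → ℂ} (hc : Summable fun n => ‖c n‖ ^ 2) :
    ‖fourierSum L c‖ ^ 2 ≤ L ^ 2 * ∑' n, ‖c n‖ ^ 2 := by
  unfold fourierSum
  by_cases h : Summable fun n =>
      c n • ContinuousMap.toLp 2 (volume : Measure (Torus L)) ℂ (expMode L n)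
  · refine le_of_tendsto ((h.hasSum.norm).pow 2) (Eventually.of_forall fun s => ?_)
    rw [norm_sum_expMode_sq]
    exact mul_le_mul_of_nonneg_left (hc.sum_le_tsum s fun n _ => sq_nonneg _) (sq_nonneg L)
  -- A non-summable `tsum` is 0 by default, so the bound is trivial here and convergence of the
  -- series need not be shown.
  · rw [tsum_eq_zero_of_not_summable h]
    have : 0 ≤ ∑' n, ‖c n‖ ^ 2 := tsum_nonneg fun n => sq_nonneg _
    simp only [norm_zero, ne_eq, OfNat.ofNat_ne_zero, not_false_eq_true, zero_pow]
    positivity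

/-- Absolutely summable coefficients make the series converge uniformly, and its L² sum is the class
of that continuous limit. -/
lemma ae_abs_realize_le {c : Modes → ℂ} (hc : Summable fun n => ‖c n‖) :
    ∀ᵐ x : Torus L, |realize L c x| ≤ ∑' n, ‖c n‖ := by
  have hle : ∀ n, ‖c n • expMode L n‖ ≤ ‖c n‖ := fun n => by
    rw [norm_smul]
    exact mul_le_of_le_one_right (norm_nonneg _) (norm_expMode_le n)
  have hs : Summable fun n => c n • expMode L n := Summable.of_norm_bounded hc hle
  have h : fourierSum L c =
      ContinuousMap.toLp 2 (volume : Measure (Torus L)) ℂ (∑' n, c n • expMode L n) := by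
    rw [ContinuousLinearMap.map_tsum _ hs]
    simp only [map_smul, fourierSum]
  have hae := ContinuousMap.coeFn_toLp (p := 2) (𝕜 := ℂ) (volume : Measure (Torus L))
    (∑' n, c n • expMode L n)
  filter_upwards [hae] with x hx
  rw [realize, h, hx]
  refine (Complex.abs_re_le_norm _).trans ((ContinuousMap.norm_coe_le_norm _ x).trans ?_)
  exact tsum_of_norm_bounded hc.hasSum hle

lemma memLp_realize (c : Modes → ℂ) : MemLp (realize L c) 2 := (Lp.memLp (fourierSum L c)).re

lemma eLpNorm_realize_toReal_le (c : Modes → ℂ) :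
    (eLpNorm (realize L c) 2 volume).toReal ≤ ‖fourierSum L c‖ := by
  rw [Lp.norm_def]
  exact ENNReal.toReal_mono (Lp.eLpNorm_ne_top _)
    (eLpNorm_mono fun x => Complex.abs_re_le_norm _)

lemma integral_abs_realize_mul_le (c d : Modes → ℂ) :
    ∫ x : Torus L, |realize L c x| * |realize L d x| ≤ ‖fourierSum L c‖ * ‖fourierSum L d‖ := by
  have hc := (memLp_realize (L := L) c).norm
  have hd := (memLp_realize (L := L) d).norm
  have h : ∫ x : Torus L, |realize L c x| * |realize L d x| = inner ℝ (hd.toLp _) (hc.toLp _) := by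
    rw [L2.inner_def]
    refine integral_congr_ae ?_
    filter_upwards [hc.coeFn_toLp, hd.coeFn_toLp] with x h1 h2
    rw [h1, h2]
    simp
  rw [h, mul_comm]
  refine (real_inner_le_norm _ _).trans ?_
  rw [Lp.norm_toLp, Lp.norm_toLp, eLpNorm_norm, eLpNorm_norm]
  exact mul_le_mul (eLpNorm_realize_toReal_le d) (eLpNorm_realize_toReal_le c)
    ENNReal.toReal_nonneg (norm_nonneg _)

lemma norm_fourierSum_le_sobNorm {α : ℕ} {c d : Modes → ℂ} (hd : sobSq L α d < ∞)
    (h : ∀ n, ‖c n‖ ≤ ‖wave L n‖ ^ α * ‖d n‖) : ‖fourierSum L c‖ ≤ sobNorm L α d := by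
  rw [sobSq_lt_top_iff Fact.out] at hd
  have hle : ∀ n, ‖c n‖ ^ 2 ≤ ‖wave L n‖ ^ (2 * α) * ‖d n‖ ^ 2 := fun n => by
    calc _ ≤ (‖wave L n‖ ^ α * ‖d n‖) ^ 2 := by gcongr; exact h n
      _ = _ := by ring
  have hc := Summable.of_nonneg_of_le (fun n => sq_nonneg _) hle hd
  refine (sq_le_sq₀ (norm_nonneg _) sobNorm_nonneg).1 ((norm_fourierSum_sq_le hc).trans ?_)
  rw [sobNorm_sq]
  exact mul_le_mul_of_nonneg_left (hc.tsum_le_tsum hle hd) (sq_nonneg L)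

lemma norm_fourierSum_pderiv_le {c : Modes → ℂ} (hc : sobSq L 1 c < ∞) (j : Fin 2) :
    ‖fourierSum L (pderiv L j c)‖ ≤ sobNorm L 1 c := by
  refine norm_fourierSum_le_sobNorm hc fun n => ?_
  rw [pderiv, norm_mul, norm_mul, Complex.norm_I, one_mul, Complex.norm_real, pow_one]
  gcongr
  exact PiLp.norm_apply_le (wave L n) j

lemma norm_fourierSum_negLap_le {c : Modes → ℂ} (hc : sobSq L 2 c < ∞) :
    ‖fourierSum L (negLap L c)‖ ≤ sobNorm L 2 c := by
  refine norm_fourierSum_le_sobNorm hc fun n => ?_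
  rw [negLap, norm_mul, Complex.norm_real, Real.norm_of_nonneg (sq_nonneg _)]

/-! ### The trilinear pairing -/

lemma ae_norm_vel_apply_le {U : Modes → EuclideanSpace ℂ (Fin 2)}
    (hU : Summable fun n => ‖U n‖) : ∀ᵐ x : Torus L, ∀ j, |vel L U x j| ≤ ∑' n, ‖U n‖ := by
  rw [ae_all_iff]
  intro j
  have hle : ∀ n, ‖U n j‖ ≤ ‖U n‖ := fun n => PiLp.norm_apply_le (U n) j
  have hj : Summable fun n => ‖U n j‖ := Summable.of_nonneg_of_le (fun n => norm_nonneg _) hle hU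
  filter_upwards [ae_abs_realize_le (L := L) hj] with x hx
  exact hx.trans (hj.tsum_le_tsum hle hU)

lemma ae_norm_vel_apply_le_supNorm {U : Modes → EuclideanSpace ℂ (Fin 2)}
    (hU : Summable fun n => ‖U n‖) : ∀ᵐ x : Torus L, ∀ j, |vel L U x j| ≤ supNorm L U := by
  -- Finiteness is essential: `supNorm` is a `toReal`, which would send an infinite norm to 0.
  have hfin : eLpNormEssSup (vel L U) volume < ∞ := by
    refine eLpNormEssSup_lt_top_of_ae_bound (C := 2 * ∑' n, ‖U n‖) ?_
    filter_upwards [ae_norm_vel_apply_le (L := L) hU] with x hx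
    have h0 : 0 ≤ ∑' n, ‖U n‖ := tsum_nonneg fun n => norm_nonneg _
    refine (sq_le_sq₀ (norm_nonneg _) (by positivity)).1 ?_
    rw [EuclideanSpace.norm_sq_eq, Fin.sum_univ_two]
    have h1 := pow_le_pow_left₀ (abs_nonneg _) (hx 0) 2
    have h2 := pow_le_pow_left₀ (abs_nonneg _) (hx 1) 2
    simp only [Real.norm_eq_abs]
    nlinarith [sq_nonneg (∑' n, ‖U n‖)]
  filter_upwards [enorm_ae_le_eLpNormEssSup (vel L U) (volume : Measure (Torus L))] with x hx j
  refine (PiLp.norm_apply_le (vel L U x) j).trans ?_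
  rw [supNorm, eLpNorm_exponent_top, ← toReal_enorm]
  exact ENNReal.toReal_mono hfin.ne hx

lemma aestronglyMeasurable_pairingDensity (v : Modes → EuclideanSpace ℂ (Fin 2))
    (η ξ : Modes → ℂ) : AEStronglyMeasurable (pairingDensity L v η ξ) volume := by
  have h : ∀ c, AEStronglyMeasurable (realize L c) volume := fun c => (memLp_realize c).1
  unfold pairingDensity advect vel
  simp only [Fin.sum_univ_two]
  exact (((h _).mul (h _)).add ((h _).mul (h _))).mul (h _)

/-- Cauchy–Schwarz is applied separately to the two summands `v_j ∂_j η` of the advection term,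
whence the factor 2. -/
lemma integrable_pairingDensity_and_abs_pairing_le {v : Modes → EuclideanSpace ℂ (Fin 2)}
    {η ξ : Modes → ℂ} {M : ℝ} (hM : 0 ≤ M) (hv : ∀ᵐ x : Torus L, ∀ j, |vel L v x j| ≤ M)
    (hη : sobSq L 1 η < ∞) (hξ : sobSq L 2 ξ < ∞) :
    Integrable (pairingDensity L v η ξ) ∧
      |pairing L v η ξ| ≤ 2 * M * sobNorm L 1 η * sobNorm L 2 ξ := by
  have hint : ∀ j, Integrable fun x : Torus L =>
      |realize L (pderiv L j η) x| * |realize L (negLap L ξ) x| := fun j =>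
    (memLp_realize _).norm.integrable_mul (memLp_realize _).norm
  have hle : ∀ j, ∫ x : Torus L, |realize L (pderiv L j η) x| * |realize L (negLap L ξ) x| ≤
      sobNorm L 1 η * sobNorm L 2 ξ := fun j =>
    (integral_abs_realize_mul_le _ _).trans (mul_le_mul (norm_fourierSum_pderiv_le hη j)
      (norm_fourierSum_negLap_le hξ) (norm_nonneg _) sobNorm_nonneg)
  have hg := ((hint 0).add (hint 1)).const_mul M
  have hae : ∀ᵐ x : Torus L, ‖pairingDensity L v η ξ x‖ ≤
      M * (|realize L (pderiv L 0 η) x| * |realize L (negLap L ξ) x| +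
        |realize L (pderiv L 1 η) x| * |realize L (negLap L ξ) x|) := by
    filter_upwards [hv] with x hx
    rw [pairingDensity, advect, Fin.sum_univ_two, Real.norm_eq_abs, abs_mul, ← add_mul,
      ← mul_assoc, mul_add]
    gcongr
    refine (abs_add_le _ _).trans ?_
    rw [abs_mul, abs_mul]
    gcongr
    · exact hx 0
    · exact hx 1
  refine ⟨hg.mono' (aestronglyMeasurable_pairingDensity v η ξ) hae, ?_⟩
  refine (norm_integral_le_of_norm_le hg hae).trans ?_
  rw [integral_const_mul]
  have : ∫ x : Torus L, (|realize L (pderiv L 0 η) x| * |realize L (negLap L ξ) x| +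
      |realize L (pderiv L 1 η) x| * |realize L (negLap L ξ) x|) ≤
      2 * (sobNorm L 1 η * sobNorm L 2 ξ) := by
    rw [integral_add (hint 0) (hint 1)]
    linarith [hle 0, hle 1]
  calc _ ≤ M * (2 * (sobNorm L 1 η * sobNorm L 2 ξ)) := mul_le_mul_of_nonneg_left this hM
    _ = _ := by ring

end FourierSeries

/-! ### The bounds on the vorticity terms -/

/-- Below `y = ν/36` the term `ν/6` suffices, above it the cubic term does. This split needs a
constant of at least `18 · 36² / 16 = 1458`, and the one in `young_six` at least `3 · 18⁵ / 5⁵ ≈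
1814`; 2000 serves both. -/
lemma young_cube {ν y : ℝ} (hν : 0 < ν) (hy : 0 ≤ y) :
    6 * y ≤ 2000 * (4 ^ 2 / (3 * ν ^ 2)) * y ^ 3 + ν / 6 := by
  have h0 : 0 ≤ 2000 * (4 ^ 2 / (3 * ν ^ 2)) * y ^ 3 := by positivity
  rcases le_total y (ν / 36) with h | h
  · linarith
  · have h1 : (ν / 36) ^ 2 ≤ y ^ 2 := by gcongr
    have h2 : 6 * y ≤ 2000 * (4 ^ 2 / (3 * ν ^ 2)) * y ^ 3 := by
      calc 6 * y = 2000 * (4 ^ 2 / (3 * ν ^ 2)) * (y * (6 * 3 * ν ^ 2 / (2000 * 16))) := by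
            field_simp
            ring
        _ ≤ 2000 * (4 ^ 2 / (3 * ν ^ 2)) * (y * y ^ 2) := by
            gcongr
            nlinarith
        _ = _ := by ring
    linarith

lemma young_six {ν y : ℝ} (hν : 0 < ν) (hy : 0 ≤ y) :
    3 * y ≤ 2000 * (5 ^ 5 / ν ^ 5) * y ^ 6 + ν / 6 := by
  have h0 : 0 ≤ 2000 * (5 ^ 5 / ν ^ 5) * y ^ 6 := by positivity
  rcases le_total y (ν / 18) with h | h
  · linarith
  · have h1 : (ν / 18) ^ 5 ≤ y ^ 5 := by gcongr
    have h2 : 3 * y ≤ 2000 * (5 ^ 5 / ν ^ 5) * y ^ 6 := by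
      calc 3 * y = 2000 * (5 ^ 5 / ν ^ 5) * (y * (3 * ν ^ 5 / (2000 * 5 ^ 5))) := by
            field_simp
        _ ≤ 2000 * (5 ^ 5 / ν ^ 5) * (y * y ^ 5) := by
            gcongr
            refine le_trans ?_ h1
            have := pow_pos hν 5
            rw [div_pow]
            rw [div_le_div_iff₀ (by positivity) (by positivity)]
            nlinarith
        _ = _ := by ring
    linarith

/-- Vanishing of `‖c‖_0` kills every coefficient and hence every norm. This ensures that the length
`τ` is positive. -/
lemma sobNorm_zero_pos {E : Type*} [NormedAddCommGroup E] {L : ℝ} (hL : 0 < L) {c : Modes → E}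
    {α : ℕ} (h0 : sobSq L 0 c < ∞) (hb : 0 < sobNorm L α c) : 0 < sobNorm L 0 c := by
  refine sobNorm_nonneg.lt_of_ne' fun ha => hb.ne' ?_
  have hs := (sobSq_lt_top_iff hL).1 h0
  have hsum : ∑' n, ‖wave L n‖ ^ (2 * 0) * ‖c n‖ ^ 2 = 0 := by
    have h := sobNorm_sq (L := L) (α := 0) (c := c)
    rw [ha] at h
    simpa [hL.ne'] using h.symm
  have hc : ∀ n, ‖c n‖ ^ 2 = 0 := fun n => by
    have h := hs.le_tsum n fun m _ => by positivity
    rw [hsum, mul_zero, pow_zero, one_mul] at h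
    exact le_antisymm h (sq_nonneg _)
  rw [← sq_eq_zero_iff, sobNorm_sq]
  simp [hc]

lemma exists_length {a b : ℝ} (ha : 0 < a) (hb : 0 < b) : ∃ τ, 0 < τ ∧ a = τ ^ 3 * b := by
  refine ⟨(a / b) ^ (1 / 3 : ℝ), by positivity, ?_⟩
  rw [← Real.rpow_natCast, ← Real.rpow_mul (by positivity)]
  norm_num
  field_simp

/-- Young's inequality at `y = τ² w`, multiplied by `b²`; then `y³ b² = a² w³`. -/
lemma cubic_bound {ν τ a b M w : ℝ} (hν : 0 < ν) (hw : 0 ≤ w) (hb : 0 ≤ b)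
    (hab : a = τ ^ 3 * b) (hM : M ≤ 3 * τ ^ 2 * b) :
    2 * M * w * b ≤ 2000 * (4 ^ 2 / (3 * ν ^ 2)) * a ^ 2 * w ^ 3 + ν / 6 * b ^ 2 := by
  have h := mul_le_mul_of_nonneg_right (young_cube hν (y := τ ^ 2 * w) (by positivity))
    (sq_nonneg b)
  calc _ ≤ 2 * (3 * τ ^ 2 * b) * w * b := by gcongr
    _ = 6 * (τ ^ 2 * w) * b ^ 2 := by ring
    _ ≤ _ := h
    _ = _ := by rw [hab]; ring

/-- Young's inequality at `y = M τ`, multiplied by `b²`; then `y⁶ b² = M⁶ a²`. The factor 3 rounds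
up `2√2`. -/
lemma sextic_bound {ν τ a b M x : ℝ} (hν : 0 < ν) (hτ : 0 ≤ τ) (hM : 0 ≤ M) (hb : 0 ≤ b)
    (hx : 0 ≤ x) (hab : a = τ ^ 3 * b) (hxb : x ^ 2 ≤ 2 * τ ^ 2 * b ^ 2) :
    2 * M * x * b ≤ 2000 * (5 ^ 5 / ν ^ 5) * M ^ 6 * a ^ 2 + ν / 6 * b ^ 2 := by
  have h := mul_le_mul_of_nonneg_right (young_six hν (y := M * τ) (by positivity)) (sq_nonneg b)
  have h1 : 2 * x ≤ 3 * τ * b := by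
    refine (sq_le_sq₀ (by positivity) (by positivity)).1 ?_
    have : 0 ≤ τ ^ 2 * b ^ 2 := by positivity
    nlinarith
  calc _ = M * (2 * x) * b := by ring
    _ ≤ M * (3 * τ * b) * b := by gcongr
    _ = 3 * (M * τ) * b ^ 2 := by ring
    _ ≤ _ := h
    _ = _ := by rw [hab]; ring

theorem vorticityBounds {L : ℝ} [Fact (0 < L)] {ν : ℝ} (hν : 0 < ν) {U v : FourierSeq}
    (hU : U ∈ Vsp L 2) (hv : v ∈ Vsp L 3) : VorticityBounds L ν 2000 U v := by
  have hL : 0 < L := Fact.out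
  obtain ⟨hUH, hU2⟩ := hU
  obtain ⟨hvH, hv3⟩ := hv
  have hv0 := sobSq_zero_lt_top hL v
  have hv2 := sobSq_two_lt_top hL hv0 hv3
  have hUs := summable_norm_of_sobSq_two hL (sobSq_zero_lt_top hL U) hU2
  have hvs := summable_norm_of_sobSq_two hL hv0 hv2
  have hMv : 0 ≤ ∑' n, ‖v n‖ := tsum_nonneg fun n => norm_nonneg _
  have hMU : 0 ≤ supNorm L U := ENNReal.toReal_nonneg
  have hξ2 : sobSq L 2 (curl L v) < ∞ := by rwa [sobSq_curl hvH]
  have hξ1 : sobSq L 1 (curl L v) < ∞ := by rwa [sobSq_curl hvH]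
  have hW1 : sobSq L 1 (curl L U) < ∞ := by rwa [sobSq_curl hUH]
  obtain ⟨i1, p1⟩ := integrable_pairingDensity_and_abs_pairing_le hMv
    (ae_norm_vel_apply_le hvs) hW1 hξ2
  obtain ⟨i2, p2⟩ := integrable_pairingDensity_and_abs_pairing_le hMv
    (ae_norm_vel_apply_le hvs) hξ1 hξ2
  obtain ⟨i3, p3⟩ := integrable_pairingDensity_and_abs_pairing_le hMU
    (ae_norm_vel_apply_le_supNorm hUs) hξ1 hξ2
  have hW : 0 ≤ sobNorm L 1 (curl L U) := sobNorm_nonneg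
  have hX : 0 ≤ sobNorm L 1 (curl L v) := sobNorm_nonneg
  have ha : 0 ≤ sobNorm L 0 v := sobNorm_nonneg
  have hb : 0 ≤ sobNorm L 2 (curl L v) := sobNorm_nonneg
  refine ⟨⟨i1, p1.trans ?_⟩, ⟨i2, p2.trans ?_⟩, ⟨i3, p3.trans ?_⟩⟩
  all_goals
    -- If `|Aξ| = 0` the Hölder bound is already 0; otherwise `τ` is defined.
    rcases hb.eq_or_lt with hb0 | hb0
    · rw [← hb0, mul_zero]
      positivity
    rw [sobNorm_curl hvH] at hb0
    obtain ⟨τ, hτ, hab⟩ := exists_length (sobNorm_zero_pos hL hv0 hb0) hb0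
    have hM := tsum_norm_le hL hvH.2.2 hv0 hv3 hτ hb0 hab
    have hx := sobNorm_two_sq_le hL hv0 hv3 hτ hab
    simp only [sobNorm_curl hvH, sobNorm_curl hUH, Nat.reduceAdd] at hb hX hW ⊢
    first
    | exact cubic_bound hν hW hb hab hM
    | exact cubic_bound hν hX hb hab hM
    | exact sextic_bound hν hτ.le hMU hb hX hab hx

/-! ### Regularity for almost every time -/

/-- A single mode contributes `L² |k|² |w_k|²` to the squared `V` norm, so continuity in `V`
controls it when `k ≠ 0`; the zero mode vanishes identically. -/
lemma IsStrongSolution.continuousOn_norm {L : ℝ} [Fact (0 < L)] {ν s : ℝ} {f : ℝ → H L}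
    {w : ℝ → DA L} (hw : IsStrongSolution L ν f s w) (n : Modes) :
    ContinuousOn (fun t => ‖(w t : FourierSeq) n‖) (Ici s) := by
  have hL : 0 < L := Fact.out
  by_cases hn : n = 0
  · have h0 : ∀ t, (w t : FourierSeq) n = 0 := fun t => hn ▸ (w t).2.1.2.2
    simp only [h0]
    exact continuousOn_const
  have hw0 : 0 < ‖wave L n‖ := norm_pos_iff.2 (wave_ne_zero L hL hn)
  intro t ht
  have h1 : Tendsto (fun τ => ‖(w τ : FourierSeq) n - (w t : FourierSeq) n‖ₑ ^ 2)
      (𝓝[Ici s] t) (𝓝 0) := by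
    set K : ℝ≥0∞ := ENNReal.ofReal (L ^ 2) * ENNReal.ofReal (‖wave L n‖ ^ (2 * 1)) with hK
    have hK0 : K ≠ 0 := by
      rw [hK, ← ENNReal.ofReal_mul (sq_nonneg L)]
      exact (ENNReal.ofReal_pos.2 (by positivity)).ne'
    have hKt : K ≠ ∞ := ENNReal.mul_ne_top ENNReal.ofReal_ne_top ENNReal.ofReal_ne_top
    have h2 := ENNReal.Tendsto.const_mul (a := K⁻¹) (hw.continuous_V t ht)
      (Or.inr (ENNReal.inv_ne_top.2 hK0))
    rw [mul_zero] at h2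
    refine tendsto_of_tendsto_of_tendsto_of_le_of_le tendsto_const_nhds h2
      (fun _ => zero_le) fun τ => ?_
    rw [← ENNReal.div_eq_inv_mul, ENNReal.le_div_iff_mul_le (Or.inl hK0) (Or.inl hKt), mul_comm,
      hK, mul_assoc, sobSq]
    gcongr
    refine le_trans (le_of_eq ?_) (ENNReal.le_tsum n)
    rw [ENNReal.ofReal_mul (by positivity), ENNReal.ofReal_pow (norm_nonneg _),
      ENNReal.ofReal_pow (norm_nonneg _), ofReal_norm, ofReal_norm]
    rfl
  have h3 : Tendsto (fun τ => ‖(w τ : FourierSeq) n - (w t : FourierSeq) n‖ ^ 2)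
      (𝓝[Ici s] t) (𝓝 0) := by
    have := (ENNReal.tendsto_toReal ENNReal.zero_ne_top).comp h1
    simpa [Function.comp_def] using this
  have h4 : Tendsto (fun τ => ‖(w τ : FourierSeq) n - (w t : FourierSeq) n‖)
      (𝓝[Ici s] t) (𝓝 0) := by
    simpa [Real.sqrt_sq_eq_abs, Function.comp_def] using h3.sqrt
  exact (tendsto_iff_norm_sub_tendsto_zero.2 h4).norm

/-- Passing from a finite lower integral to finiteness almost everywhere requires measurability,
supplied mode by mode and passed to the countable sum. -/
lemma IsStrongSolution.ae_sobSq_lt_top {L : ℝ} [Fact (0 < L)] {ν s : ℝ} {f : ℝ → H L}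
    {w : ℝ → DA L} (hw : IsStrongSolution L ν f s w) {α : ℕ} {S : Set ℝ} (hS : MeasurableSet S)
    (hsub : S ⊆ Ici s) (hfin : ∫⁻ t in S, sobSq L α (w t : FourierSeq) < ∞) :
    ∀ᵐ t, t ∈ S → sobSq L α (w t : FourierSeq) < ∞ := by
  rw [← ae_restrict_iff' hS]
  refine ae_lt_top' ?_ hfin.ne
  unfold sobSq
  refine AEMeasurable.const_mul (AEMeasurable.tsum fun n => ?_) _
  have h := ((hw.continuousOn_norm n).mono hsub).aemeasurable hS (μ := volume)
  exact ((h.pow_const 2).const_mul _).ennreal_ofReal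

lemma ae_exists_mem_Ioo {t₀ δ : ℝ} (hδ : 0 < δ) :
    ∀ᵐ t : ℝ, t₀ ≤ t → ∃ n : ℕ, t₀ + n * δ < t ∧ t < t₀ + (n + 1 : ℕ) * δ := by
  have h : ∀ᵐ t : ℝ, ∀ n : ℕ, t ≠ t₀ + n * δ := by
    rw [ae_all_iff]
    exact fun n => Measure.ae_ne _ _
  filter_upwards [h] with t ht h0
  have h1 : 0 ≤ (t - t₀) / δ := div_nonneg (by linarith) hδ.le
  refine ⟨⌊(t - t₀) / δ⌋₊, (lt_of_le_of_ne ?_ (ht _).symm), ?_⟩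
  · have := (le_div_iff₀ hδ).1 (Nat.floor_le h1)
    linarith
  · have := (div_lt_iff₀ hδ).1 (Nat.lt_floor_add_one ((t - t₀) / δ))
    push_cast
    linarith

theorem ae_sub_mem_Vsp {L : ℝ} [Fact (0 < L)] {ν t₀ δ lam : ℝ} (hδ : 0 < δ)
    {Ih : DA L →ₗ[ℝ] Lp (EuclideanSpace ℝ (Fin 2)) 2 (volume : Measure (Torus L))}
    {f : ℝ → H L} {U u : ℝ → DA L} (hU : IsStrongSolution L ν f t₀ U)
    (hu : IsAssimilation L ν f t₀ δ lam Ih U u)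
    (hU3 : ∀ t ≥ t₀, ∫⁻ s in Icc t (t + δ), sobSq L 3 (U s : FourierSeq) < ∞)
    (hu3 : ∀ (n : ℕ) (a b : ℝ), t₀ + n * δ < a → b < t₀ + (n + 1 : ℕ) * δ →
      ∫⁻ s in Icc a b, sobSq L 3 (u s : FourierSeq) < ∞) :
    ∀ᵐ t, t₀ ≤ t → ((U t - u t : DA L) : FourierSeq) ∈ Vsp L 3 := by
  obtain ⟨w, hw, -, -, huw⟩ := hu
  have h1 : ∀ᵐ t, ∀ n : ℕ, t ∈ Icc (t₀ + n * δ) (t₀ + n * δ + δ) →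
      sobSq L 3 (U t : FourierSeq) < ∞ := by
    rw [ae_all_iff]
    intro n
    have hn : t₀ ≤ t₀ + n * δ := le_add_of_nonneg_right (by positivity)
    exact hU.ae_sobSq_lt_top measurableSet_Icc (fun t ht => hn.trans ht.1) (hU3 _ hn)
  -- Integrability of `u` is known only on compact subintervals between observation times. Rational
  -- endpoints keep the exceptional sets countable in number, and `w n`, which agrees with `u`
  -- there, provides the measurability.
  have h2 : ∀ᵐ t, ∀ (n : ℕ) (a b : ℚ), t₀ + n * δ < a → b < t₀ + (n + 1 : ℕ) * δ →
      t ∈ Icc (a : ℝ) b → sobSq L 3 (w n t : FourierSeq) < ∞ := by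
    simp only [ae_all_iff]
    intro n a b ha hb
    refine (hw n).ae_sobSq_lt_top measurableSet_Icc (fun t ht => ha.le.trans ht.1) ?_
    refine lt_of_eq_of_lt (setLIntegral_congr_fun measurableSet_Icc fun t ht => ?_)
      (hu3 n a b ha hb)
    simp only [huw n t ⟨ha.le.trans ht.1, ht.2.trans_lt hb⟩]
  filter_upwards [h1, h2, ae_exists_mem_Ioo hδ] with t hUt hwt hn ht
  obtain ⟨n, hn1, hn2⟩ := hn ht
  obtain ⟨a, ha1, ha2⟩ := exists_rat_btwn hn1
  obtain ⟨b, hb1, hb2⟩ := exists_rat_btwn hn2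
  have hU' : (U t : FourierSeq) ∈ Vsp L 3 := by
    refine ⟨(U t).2.1, hUt n ⟨hn1.le, ?_⟩⟩
    push_cast at hn2
    linarith
  have hu' : (u t : FourierSeq) ∈ Vsp L 3 := by
    refine ⟨(u t).2.1, ?_⟩
    rw [huw n t ⟨hn1.le, hn2⟩]
    exact hwt n a b ha1 hb2 ⟨ha2.le, hb1.le⟩
  exact sub_mem hU' hu'

end NSE

theorem mainTheorem8 :
    ∃ C : ℝ, 0 < C ∧ ∀ (L : ℝ) [Fact (0 < L)] (ν : ℝ), 0 < ν →
      (∀ U ∈ NSE.Vsp L 2, ∀ v ∈ NSE.Vsp L 3, NSE.VorticityBounds L ν C U v) ∧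
      (∀ (t₀ δ h lam c₁ : ℝ), 0 < δ → 0 < h → 0 < lam → 0 < c₁ →
        ∀ (Ih : NSE.DA L →ₗ[ℝ]
            Lp (EuclideanSpace ℝ (Fin 2)) 2 (volume : Measure (NSE.Torus L)))
          (f : ℝ → NSE.H L) (U u : ℝ → NSE.DA L),
        NSE.IsTypeII L h c₁ Ih →
        MemLp f ∞ (volume.restrict (Ici t₀)) →
        NSE.IsStrongSolution L ν f t₀ U →
        NSE.IsAssimilation L ν f t₀ δ lam Ih U u →
        (∀ t ≥ t₀, ∫⁻ s in Icc t (t + δ), NSE.sobSq L 3 (U s : NSE.FourierSeq) < ∞) →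
        (∀ (n : ℕ) (a b : ℝ), t₀ + n * δ < a → b < t₀ + (n + 1 : ℕ) * δ →
          ∫⁻ s in Icc a b, NSE.sobSq L 3 (u s : NSE.FourierSeq) < ∞) →
        ∀ᵐ t, t₀ ≤ t →
          ((U t - u t : NSE.DA L) : NSE.FourierSeq) ∈ NSE.Vsp L 3 ∧
          NSE.VorticityBounds L ν C (U t : NSE.FourierSeq)
            ((U t - u t : NSE.DA L) : NSE.FourierSeq)) := by
  refine ⟨2000, by norm_num, fun L _ ν hν => ⟨fun U hU v hv => NSE.vorticityBounds hν hU hv, ?_⟩⟩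
  intro t₀ δ h lam c₁ hδ _ _ _ Ih f U u _ _ hU hu hU3 hu3
  filter_upwards [NSE.ae_sub_mem_Vsp hδ hU hu hU3 hu3] with t ht h0
  exact ⟨ht h0, NSE.vorticityBounds hν (U t).2 (ht h0)⟩
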